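/- For $T\ge 1$ put $\Delta=\frac1{16\sqrt T}$, let $0<\varepsilon<\Delta$, and consider the three-armed bandit with model class $\{M_1,M_2\}$, where the rewards of the arms $(a_1,a_2,a_3)$ are distributed as follows ($\varepsilon\,\mathrm{Ber}(\frac12)$ is the law that is $0$ or $\varepsilon$ with equal probability): $$M_1=\big(\mathrm{Ber}(\tfrac12-\Delta),\ \mathrm{Ber}(\tfrac12+\Delta),\ \varepsilon\,\mathrm{Ber}(\tfrac12)\big),\qquad M_2=\big(\mathrm{Ber}(\tfrac12+\Delta),\ \mathrm{Ber}(\tfrac12-\Delta),\ \tfrac{\varepsilon}{2}\big).$$ The observation is the reward of the pulled arm. $V_M(a)$ is the mean reward of $a$ under $M$, and $a_M$ is the best arm under $M$. The infosets are the singletons $\phi_i=\{(M_i,a_{M_i})\}$, $\Phi=\{\phi_1,\phi_2\}$, $V_{\phi_i}=V_{M_i}$, $a_{\phi_i}=a_{M_i}$, and $D^a(\phi\|M)=(V_\phi(a)-V_M(a))^2$. When the true model is $M^\star$, the regret against arm $a$ is $\mathrm{Reg}(a)=\sum_{t=1}^T (V_{M^\star}(a)-V_{M^\star}(a_t))$,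 where $a_t$ is the arm pulled in round $t$. *Optimistic E2D* (Foster et al., 2024) with parameter $\eta>0$: given the distribution $\rho_t\in\Delta(\Phi)$ returned by an estimation oracle as a function of the past, the arm is drawn from a solution $p_t$ of $$\min_{p}\max_{\nu\in\Delta(\Phi)}\ \mathbb E_{a\sim p}\mathbb E_{\phi\sim\rho_t}\mathbb E_{M\sim\nu}\Big[V_\phi(a_\phi)-V_M(a)-\tfrac1\eta D^a(\phi\|M)\Big];$$ in the version with batch length $\tau\ge1$ this is done in the first round of each batch of $\tau$ rounds and the arm is repeated within the batch ($\tau=1$ is the unbatched version). *The dual-information-gain (Dig-DEC) algorithm* with parameter $\eta>0$: $\rho_1$ is uniform on $\Phi$; in round $t$ take a saddle point $(p_t,\nu_t)$ (min over $p$, max over $\nu\in\Delta(\Phi)$) of $$\mathbb E_{a\sim p}\mathbb E_{M\sim\nu}\Big[V_M(a_M)-V_M(a)-\tfrac1\eta\mathbb E_{o\sim M(\cdot|a)}\big[\mathrm{KL}(\nu(\cdot|a,o),\rho_t)\big]-\tfrac1\eta\mathbb E_{\phi\sim\rho_t}[D^a(\phi\|M)]\Big],$$ where $\nu(\phi|a,o)\propto\nu(\phi)M_\phi(o|a)$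 is the posterior; draw $a_t\sim p_t$, observe $o_t$, and let $$\rho_{t+1}\in\operatorname*{argmin}_{\rho\in\Delta(\Phi)}\Big\{\langle\rho,L_t+4\gamma L_t^2+b_t\rangle+\mathrm{KL}(\rho,\nu_t(\cdot|a_t,o_t))+\tfrac1\gamma\mathrm{KL}(\rho,\rho_t)\Big\},$$ with $\iota=64\log|\Phi|$, $\gamma=\frac1{4\iota}$, $\ell_t(\phi)=(V_\phi(a_t)-o_t)^2$, $L_t(\phi)=\ell_t(\phi)-\mathbb E_{\phi'\sim q_t(\cdot|\phi)}[\ell_t(\phi')]$, $b_t(\phi)=\iota\,[\rho_t(\phi)-\max_{s<t}\rho_s(\phi)]_+/\rho_t(\phi)$ (an empty maximum is $0$, and $0/0=0$), $q_1(\cdot|\phi)$ uniform, and $q_{t}(\phi'|\phi)\propto\exp\big(-\frac{1}{16\max_{s<t}\rho_s(\phi)}\sum_{s<t}\rho_s(\phi)\ell_s(\phi')\big)$ for $t\ge 2$. **Theorem.** There is an absolute constant $c>0$ such that, for every $T\ge1$, every $0<\varepsilon<\Delta$ and every $0<\eta\le1$, the following holds on the bandit above. 1. For every estimation oracle and every batch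 length $\tau\ge 1$, optimistic E2D is well defined (the minimax problems have solutions), and, whatever minimax solutions it uses, under either model it never pulls $a_3$ (with probability one), and for at least one of the two models as the true model, $\max_a\mathbb E[\mathrm{Reg}(a)]\ge c\sqrt T$. 2. The Dig-DEC algorithm is well defined (the saddle points and minimizers exist along all its possible histories), and, whatever saddle points and minimizers it uses and whichever model $M^\star$ is the true one, it pulls $a_3$ in the first round with probability one, from the second round on its belief $\rho_t$ is the point mass at the infoset of $M^\star$ and it pulls only the optimal arm of $M^\star$, and $\max_a\mathbb E[\mathrm{Reg}(a)]\le 1$. -/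

import Mathlib

open scoped ENNReal BigOperators

noncomputable section

/-- A finite stochastic decision problem with structured observations: `I` indexes the models,
`A` the arms, `O` the observations. Playing `a` under model `i` produces an observation drawn from
`law i a`, which carries the reward `reward o`.
The information sets are the singletons `{(M_i, π_{M_i})}`; hence infosets, models and pairs
(model, optimal arm) are all indexed by `I`. -/
structure FiniteDMSO (I A O : Type) [Fintype O] where
  law : I → A → O → ℝ
  law_mem : ∀ i a, law i a ∈ stdSimplex ℝ O
  reward : O → ℝ

/-- The sequence of the first `t` (arm, observation) pairs. -/
abbrev Hist (A O : Type) (t : ℕ) : Type := Fin t → A × O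

/-- The first `t` rounds of a history of `T` rounds. -/
def Hist.take {A O : Type} {T : ℕ} (x : Hist A O T) (t : ℕ) (ht : t ≤ T) : Hist A O t :=
  fun s => x (Fin.castLE ht s)

/-- A map choosing, in every round and for every past history, a distribution on `X`. Rounds are
counted from `0`, so the round in which `t` pairs are already known is the `(t+1)`-st one. -/
abbrev HistRule (A O X : Type) [Fintype X] : Type :=
  (t : ℕ) → Hist A O t → stdSimplex ℝ X

/-- The Kullback-Leibler divergence of two finite vectors of nonnegative weights. -/
def klVec {I : Type} [Fintype I] [MeasurableSpace I] (q r : I → ℝ) : ℝ≥0∞ :=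
  InformationTheory.klDiv
    (∑ i, ENNReal.ofReal (q i) • MeasureTheory.Measure.dirac i)
    (∑ i, ENNReal.ofReal (r i) • MeasureTheory.Measure.dirac i)

namespace FiniteDMSO

variable {I A O : Type} [Fintype I] [Fintype A] [Fintype O]

/-- The mean reward `V_{M_i}(a)`. -/
def value (B : FiniteDMSO I A O) (i : I) (a : A) : ℝ :=
  ∑ o, B.law i a o * B.reward o

/-- The optimal value `V_{M_i}(π_{M_i}) = max_a V_{M_i}(a)`. -/
def optValue (B : FiniteDMSO I A O) (i : I) : ℝ := ⨆ a, B.value i a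

/-! ### Interaction and regret -/

/-- Probability that the learner who draws the arm from `p t h` after history `h` generates the
history `x` when the true model is `i`. -/
def histProb (B : FiniteDMSO I A O) (p : HistRule A O A) (i : I) {T : ℕ} (x : Hist A O T) : ℝ :=
  ∏ t : Fin T, (p t (x.take t t.isLt.le)).1 (x t).1 * B.law i (x t).1 (x t).2

/-- The history can occur under some model of the class. -/
def Reachable (B : FiniteDMSO I A O) (p : HistRule A O A) {T : ℕ} (x : Hist A O T) : Prop :=
  ∃ i, 0 < B.histProb p i x

/-- Expected regret over `T` rounds against the fixed arm `a` when the true model is `i`. -/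
def expectedRegret (B : FiniteDMSO I A O) (p : HistRule A O A) (i : I) (T : ℕ) (a : A) : ℝ :=
  ∑ x : Hist A O T, B.histProb p i x * ∑ t, (B.value i a - B.value i (x t).1)

/-! ### Optimistic E2D -/

/-- The divergence `D^a(φ ‖ M) = (V_φ(a) - V_M(a))²`: in a bandit, both the bilinear divergence
and the squared Bellman error. -/
def meanDiv (B : FiniteDMSO I A O) (a : A) (φ m : I) : ℝ :=
  (B.value φ a - B.value m a) ^ 2

/-- The objective
`E_{a∼p} E_{φ∼ρ} E_{M∼ν} [V_φ(a_φ) - V_M(a) - D^a(φ‖M) / η]` of optimistic E2D. -/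
def optimisticObj (B : FiniteDMSO I A O) (η : ℝ) (ρ : stdSimplex ℝ I)
    (p : stdSimplex ℝ A) (ν : stdSimplex ℝ I) : ℝ :=
  ∑ a, p.1 a * ∑ φ, ρ.1 φ * ∑ m, ν.1 m *
    (B.optValue φ - B.value m a - 1 / η * B.meanDiv a φ m)

/-- `p` is a run of optimistic E2D with parameter `η` and batch length `τ`, when the estimation
oracle returns the distributions `ρ` on the infosets. At the beginning of each batch the arm is
drawn from a solution of the min-max problem; inside a batch the same arm is repeated. The
unbatched algorithm is `τ = 1`. -/
structure IsOptimisticE2D (B : FiniteDMSO I A O) (η : ℝ) (τ : ℕ) (ρ : HistRule A O I)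
    (p : HistRule A O A) : Prop where
  minimax : ∀ (t : ℕ) (h : Hist A O t), B.Reachable p h → τ ∣ t → ∀ p' : stdSimplex ℝ A,
    (⨆ ν, B.optimisticObj η (ρ t h) (p t h) ν) ≤ ⨆ ν, B.optimisticObj η (ρ t h) p' ν
  batch : ∀ (t : ℕ) (h : Hist A O (t + 1)), B.Reachable p h → ¬ τ ∣ t + 1 →
    (p (t + 1) h).1 (h (Fin.last t)).1 = 1

/-! ### E2D with dual information gain -/

/-- The posterior `ν(φ | a, o) ∝ ν(φ) M_φ(o | a)`. -/
def posterior (B : FiniteDMSO I A O) (ν : stdSimplex ℝ I) (a : A) (o : O) (φ : I) : ℝ :=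
  ν.1 φ * B.law φ a o / ∑ m, ν.1 m * B.law m a o

/-- The information gain `E_{a∼p} E_{M∼ν} E_{o∼M(·|a)} [KL(ν(· | a, o), ρ)]`. -/
def infoGain [MeasurableSpace I] (B : FiniteDMSO I A O) (ρ : stdSimplex ℝ I)
    (p : stdSimplex ℝ A) (ν : stdSimplex ℝ I) : ℝ≥0∞ :=
  ∑ a, ENNReal.ofReal (p.1 a) * ∑ m, ENNReal.ofReal (ν.1 m) *
    ∑ o, ENNReal.ofReal (B.law m a o) * klVec (B.posterior ν a o) ρ.1

/-- The objective
`E_{a∼p} E_{M∼ν} [V_M(a_M) - V_M(a) - E_{o∼M(·|a)}[KL(ν(·|a,o), ρ)] / η - E_{φ∼ρ}[D^a(φ‖M)] / η]`,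
which may be `-∞`. -/
def air [MeasurableSpace I] (B : FiniteDMSO I A O) (η : ℝ) (ρ : stdSimplex ℝ I)
    (p : stdSimplex ℝ A) (ν : stdSimplex ℝ I) : EReal :=
  ((∑ a, p.1 a * ∑ m, ν.1 m * (B.optValue m - B.value m a
      - 1 / η * ∑ φ, ρ.1 φ * B.meanDiv a φ m) : ℝ) : EReal)
    - ((ENNReal.ofReal (1 / η) * B.infoGain ρ p ν : ℝ≥0∞) : EReal)

/-- The squared estimation loss `Δ(φ', φ) = (V_{φ'}(a) - r)²` of a round with outcome `(a, o)`. In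
a bandit (one step, bounded by one) it does not depend on the second infoset. -/
def sqLoss (B : FiniteDMSO I A O) (φ' : I) (z : A × O) : ℝ :=
  (B.value φ' z.1 - B.reward z.2) ^ 2

/-- `max_s ρ_s(φ)` over the rounds `s` of the history `h`; it is `0` for the empty history. -/
def maxBelief (ρ : HistRule A O I) {t : ℕ} (h : Hist A O t) (φ : I) : ℝ :=
  ⨆ s : Fin t, (ρ s (h.take s s.isLt.le)).1 φ

/-- Unnormalised inner weights
`exp(- (16 max_s ρ_s(φ))⁻¹ ∑_s ρ_s(φ) Δ_s(φ', φ))`, `s` over the rounds of `h`. -/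
def innerWeight (B : FiniteDMSO I A O) (ρ : HistRule A O I) {t : ℕ} (h : Hist A O t)
    (φ φ' : I) : ℝ :=
  Real.exp (-(1 / (16 * maxBelief ρ h φ)) *
    ∑ s : Fin t, (ρ s (h.take s s.isLt.le)).1 φ * B.sqLoss φ' (h s))

/-- The inner distribution `q(φ' | φ)` after history `h`; uniform if `h` is empty. -/
def innerDist (B : FiniteDMSO I A O) (ρ : HistRule A O I) {t : ℕ} (h : Hist A O t)
    (φ φ' : I) : ℝ :=
  B.innerWeight ρ h φ φ' / ∑ ψ, B.innerWeight ρ h φ ψ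

/-- The constant `ι = 64 log |Φ|`. -/
def iotaConst (I : Type) [Fintype I] : ℝ := 64 * Real.log (Fintype.card I)

/-- The step size `γ = 1 / (4 ι)`. -/
def gammaConst (I : Type) [Fintype I] : ℝ := 1 / (4 * iotaConst I)

/-- `L_t(φ) = Δ_t(φ, φ) - E_{φ'∼q_t(·|φ)}[Δ_t(φ', φ)]` for the last round of `h`. -/
def outerLoss (B : FiniteDMSO I A O) (ρ : HistRule A O I) {t : ℕ} (h : Hist A O (t + 1))
    (φ : I) : ℝ :=
  B.sqLoss φ (h (Fin.last t)) -
    ∑ φ', B.innerDist ρ (h.take t t.le_succ) φ φ' * B.sqLoss φ' (h (Fin.last t))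

/-- `b_t(φ) = ι [ρ_t(φ) - max_{s<t} ρ_s(φ)]₊ / ρ_t(φ)` for the last round of `h`. -/
def bias (ρ : HistRule A O I) {t : ℕ} (h : Hist A O (t + 1)) (φ : I) : ℝ :=
  max ((ρ t (h.take t t.le_succ)).1 φ - maxBelief ρ (h.take t t.le_succ) φ) 0
    / (ρ t (h.take t t.le_succ)).1 φ * iotaConst I

/-- The objective of the belief update after the last round `(a_t, o_t)` of `h`:
`⟨r, L_t + 4 γ L_t² + b_t⟩ + KL(r, ν_t(· | a_t, o_t)) + KL(r, ρ_t) / γ`. -/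
def updateObj [MeasurableSpace I] (B : FiniteDMSO I A O) (ν ρ : HistRule A O I) {t : ℕ}
    (h : Hist A O (t + 1)) (r : stdSimplex ℝ I) : EReal :=
  ((∑ φ, r.1 φ * (B.outerLoss ρ h φ + 4 * gammaConst I * B.outerLoss ρ h φ ^ 2
      + bias ρ h φ) : ℝ) : EReal)
    + ((klVec r.1 (B.posterior (ν t (h.take t t.le_succ))
          (h (Fin.last t)).1 (h (Fin.last t)).2)
        + ENNReal.ofReal (1 / gammaConst I)
          * klVec r.1 (ρ t (h.take t t.le_succ)).1 : ℝ≥0∞) : EReal)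

/-- `p, ν, ρ` is a run of the dual-information-gain E2D algorithm with parameter `η`, with
bi-level squared-error belief updates: the belief starts uniform, in every round `(p_t, ν_t)` is a
saddle point of the objective `air`, and the next belief minimises `updateObj`. -/
structure IsDigE2D [MeasurableSpace I] (B : FiniteDMSO I A O) (η : ℝ) (p : HistRule A O A)
    (ν ρ : HistRule A O I) : Prop where
  init : ∀ (h : Hist A O 0) (φ : I), (ρ 0 h).1 φ = 1 / Fintype.card I
  saddle : ∀ (t : ℕ) (h : Hist A O t), B.Reachable p h →
    IsSaddlePointOn Set.univ Set.univ (B.air η (ρ t h)) (p t h) (ν t h)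
  update : ∀ (t : ℕ) (h : Hist A O (t + 1)), B.Reachable p h → ∀ r : stdSimplex ℝ I,
    B.updateObj ν ρ h (ρ (t + 1) h) ≤ B.updateObj ν ρ h r

end FiniteDMSO

/-! ### The three-armed bandit -/

/-- `Δ = 1 / (16 √T)`. -/
def gap (T : ℕ) : ℝ := 1 / (16 * √(T : ℝ))

/-- The four possible observations stand for the rewards `0, ε/2, ε, 1`; this is the law of a
Bernoulli reward with mean `x`. -/
def berReward (x : ℝ) : Fin 4 → ℝ := ![1 - x, 0, 0, x]

lemma gap_mem (T : ℕ) : 0 ≤ gap T ∧ gap T ≤ 1 / 2 := by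
  unfold gap
  refine ⟨by positivity, ?_⟩
  rcases Nat.eq_zero_or_pos T with rfl | hT
  · norm_num
  · have h1 : (1 : ℝ) ≤ √(T : ℝ) := by
      rw [Real.one_le_sqrt]; exact_mod_cast hT
    rw [div_le_div_iff₀ (by positivity) (by norm_num)]
    linarith

lemma berReward_mem {x : ℝ} (h0 : 0 ≤ x) (h1 : x ≤ 1) : berReward x ∈ stdSimplex ℝ (Fin 4) := by
  refine ⟨fun o => ?_, ?_⟩
  · fin_cases o <;> simp [berReward] <;> linarith
  · simp [berReward, Fin.sum_univ_four]

/-- The law of the reward of each arm. First model: `Ber(1/2 - Δ)`, `Ber(1/2 + Δ)`, and `0` or `ε`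
with probability `1/2` each. Second model: `Ber(1/2 + Δ)`, `Ber(1/2 - Δ)`, and the constant
`ε/2`. -/
def threeArmLaw (T : ℕ) : Fin 2 → Fin 3 → Fin 4 → ℝ :=
  ![![berReward (1 / 2 - gap T), berReward (1 / 2 + gap T), ![1 / 2, 0, 1 / 2, 0]],
    ![berReward (1 / 2 + gap T), berReward (1 / 2 - gap T), ![0, 1, 0, 0]]]

lemma threeArmLaw_mem (T : ℕ) (i : Fin 2) (a : Fin 3) :
    threeArmLaw T i a ∈ stdSimplex ℝ (Fin 4) := by
  obtain ⟨h0, h1⟩ := gap_mem T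
  have hp := berReward_mem (x := 1 / 2 + gap T) (by linarith) (by linarith)
  have hm := berReward_mem (x := 1 / 2 - gap T) (by linarith) (by linarith)
  have h3 : (![1 / 2, 0, 1 / 2, 0] : Fin 4 → ℝ) ∈ stdSimplex ℝ (Fin 4) := by
    refine ⟨fun o => ?_, ?_⟩
    · fin_cases o <;> simp
    · simp [Fin.sum_univ_four]; norm_num
  have h4 : (![0, 1, 0, 0] : Fin 4 → ℝ) ∈ stdSimplex ℝ (Fin 4) := by
    refine ⟨fun o => ?_, ?_⟩
    · fin_cases o <;> simp
    · simp [Fin.sum_univ_four]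
  fin_cases i <;> fin_cases a <;> first | exact hp | exact hm | exact h3 | exact h4

/-- The three-armed bandit with two models, for horizon `T` and reward scale `ε` of the third
arm. -/
def threeArm (T : ℕ) (ε : ℝ) : FiniteDMSO (Fin 2) (Fin 3) (Fin 4) where
  law := threeArmLaw T
  law_mem := threeArmLaw_mem T
  reward := ![0, ε / 2, ε, 1]

end

/-! The third arm has the same mean `ε / 2` under both models, but the supports of its rewards are
disjoint: it is worthless for reward and for every mean-based divergence, yet one pull identifies
the model.

Optimistic E2D sees only means. Splitting the mass of the third arm equally between the other two
raises the mean reward under either model and can only increase the subtracted divergence, so no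
minimax solution uses that arm (`minimax_third_eq_zero`), and repeating arms within a batch does not
change this. What remains is a two-point testing problem with gap `Δ = 1 / (16 √T)`. The
Bhattacharyya affinity of the two laws of histories is `(1 - 4Δ²)^(T/2) ≥ 63/64`
(`sum_sqrt_histProb`), so the models cannot be told apart, and the two regrets, whose sum on each
history of the first two arms is `2TΔ = √T / 8` before weighting, cannot both be small
(`exists_regret_ge`).

Dig-DEC is rewarded for information. At the uniform belief the third arm gains exactly `log 2`, the
others only `O(Δ²)`; as `η ≤ 1`, this outweighs the loss of about `1/2` in reward, so every saddle
point pulls it (`saddle_barycenter`). The adversary's distribution has full support there, so the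
posterior is the point mass at the truth. A KL term relative to a point mass is infinite elsewhere,
which forces the next belief whatever the finite losses and biases are (`updateObj_minimal_iff`). A
point-mass belief then persists and only optimal arms are pulled (`isSaddlePointOn_air_vertex_iff`),
so only the first round can contribute positive regret. -/

/-! ### The Kullback-Leibler divergence of finite vectors -/

section klVec

open MeasureTheory InformationTheory

variable {I : Type} [Fintype I] [MeasurableSpace I]

instance isFiniteMeasure_sum_ofReal_smul_dirac (q : I → ℝ) :
    IsFiniteMeasure (∑ j, ENNReal.ofReal (q j) • Measure.dirac j : Measure I) := by
  refine ⟨?_⟩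
  rw [Measure.finsetSum_apply]
  simp

lemma klVec_self (q : I → ℝ) : klVec q q = 0 := klDiv_self _

variable [MeasurableSingletonClass I]

lemma sum_ofReal_smul_dirac_singleton (q : I → ℝ) (i : I) :
    (∑ j, ENNReal.ofReal (q j) • Measure.dirac j : Measure I) {i} = ENNReal.ofReal (q i) := by
  classical
  rw [Measure.finsetSum_apply, Finset.sum_eq_single i]
  · simp
  · intro j _ hj
    simp [hj]
  · simp

lemma klVec_eq_top {q r : I → ℝ} {i : I} (hq : 0 < q i) (hr : r i ≤ 0) : klVec q r = ∞ := by
  refine klDiv_of_not_ac fun h => ?_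
  have h0 := h (s := {i}) (by simp [sum_ofReal_smul_dirac_singleton, hr])
  rw [sum_ofReal_smul_dirac_singleton, ENNReal.ofReal_eq_zero] at h0
  linarith

lemma klVec_eq_sum {q r : I → ℝ} (hq : ∀ i, 0 ≤ q i) (hr : ∀ i, 0 < r i) :
    klVec q r = ∑ i, ENNReal.ofReal (r i * klFun (q i / r i)) := by
  set μ : Measure I := ∑ i, ENNReal.ofReal (q i) • Measure.dirac i with hμ
  set ν : Measure I := ∑ i, ENNReal.ofReal (r i) • Measure.dirac i with hν
  have hf : Measurable fun i => ENNReal.ofReal (q i / r i) :=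
    measurable_of_countable _
  -- All weights of `ν` are positive, so the ratio of weights is a genuine density.
  have hw : μ = ν.withDensity fun i => ENNReal.ofReal (q i / r i) := by
    refine Measure.ext_of_singleton fun i => ?_
    rw [withDensity_apply _ (measurableSet_singleton i), lintegral_singleton, hμ, hν,
      sum_ofReal_smul_dirac_singleton, sum_ofReal_smul_dirac_singleton,
      ← ENNReal.ofReal_mul (div_nonneg (hq i) (hr i).le), div_mul_cancel₀ _ (hr i).ne']
  have hac : μ ≪ ν := hw ▸ withDensity_absolutelyContinuous _ _
  have hd : μ.rnDeriv ν =ᵐ[ν] fun i => ENNReal.ofReal (q i / r i) := by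
    rw [hw]
    exact Measure.rnDeriv_withDensity ν hf
  calc klVec q r = klDiv μ ν := rfl
    _ = ∫⁻ i, ENNReal.ofReal (klFun (μ.rnDeriv ν i).toReal) ∂ν :=
      klDiv_eq_lintegral_klFun_of_ac hac
    _ = ∫⁻ i, ENNReal.ofReal (klFun (q i / r i)) ∂ν := by
      refine lintegral_congr_ae ?_
      filter_upwards [hd] with i hi
      rw [hi, ENNReal.toReal_ofReal (div_nonneg (hq i) (hr i).le)]
    _ = ∑ i, ENNReal.ofReal (r i * klFun (q i / r i)) := by
      rw [hν, lintegral_finsetSum_measure]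
      refine Finset.sum_congr rfl fun i _ => ?_
      rw [lintegral_smul_measure, lintegral_dirac, smul_eq_mul, ENNReal.ofReal_mul (hr i).le]

/-- The Kullback-Leibler divergence is at most the chi-squared divergence. -/
lemma klVec_le_chiSq {q r : I → ℝ} (hq : ∀ i, 0 ≤ q i) (hr : ∀ i, 0 < r i) :
    klVec q r ≤ ENNReal.ofReal (∑ i, (q i - r i) ^ 2 / r i) := by
  rw [klVec_eq_sum hq hr, ENNReal.ofReal_sum_of_nonneg
    fun i _ => div_nonneg (sq_nonneg _) (hr i).le]
  refine Finset.sum_le_sum fun i _ => ENNReal.ofReal_le_ofReal ?_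
  have hx : 0 ≤ q i / r i := div_nonneg (hq i) (hr i).le
  -- `klFun x = x log x + 1 - x`, and `log x ≤ x - 1` turns this into at most `(x - 1)²`.
  have hk : klFun (q i / r i) ≤ (q i / r i - 1) ^ 2 := by
    rw [klFun_apply]
    have : q i / r i * Real.log (q i / r i) ≤ q i / r i * (q i / r i - 1) := by
      rcases hx.eq_or_lt with h | h
      · simp [← h]
      · exact mul_le_mul_of_nonneg_left (Real.log_le_sub_one_of_pos h) hx
    nlinarith
  calc r i * klFun (q i / r i) ≤ r i * (q i / r i - 1) ^ 2 :=
        mul_le_mul_of_nonneg_left hk (hr i).le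
    _ = (q i - r i) ^ 2 / r i := by
        have := (hr i).ne'
        field_simp

end klVec

/-! ### Vertices of the simplex -/

section Simplex

variable {I : Type} [Fintype I]

lemma stdSimplex.eq_of_vertex_pos [DecidableEq I] {i j : I}
    (h : 0 < (stdSimplex.vertex i : stdSimplex ℝ I).1 j) : j = i := by
  by_contra hne
  simp [hne] at h

lemma stdSimplex.eq_vertex_of_apply_eq_one [DecidableEq I] {r : stdSimplex ℝ I} {i : I}
    (h : r.1 i = 1) : r = stdSimplex.vertex i := by
  have h0 : ∀ j, j ≠ i → r.1 j = 0 := by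
    intro j hj
    have hs := r.2.2
    rw [← Finset.add_sum_erase _ _ (Finset.mem_univ i), h] at hs
    have h1 := Finset.single_le_sum (f := r.1) (fun k _ => r.2.1 k)
      (Finset.mem_erase.2 ⟨hj, Finset.mem_univ j⟩)
    exact le_antisymm (by linarith) (r.2.1 j)
  refine Subtype.ext (funext fun j => ?_)
  rcases eq_or_ne j i with rfl | hj
  · simp [h]
  · simp [h0 j hj, hj]

lemma stdSimplex.eq_vertex_of_forall_eq_zero [DecidableEq I] {r : stdSimplex ℝ I} {i : I}
    (h : ∀ j, j ≠ i → r.1 j = 0) : r = stdSimplex.vertex i := by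
  refine eq_vertex_of_apply_eq_one ?_
  rw [← r.2.2, Finset.sum_eq_single i (fun j _ hj => h j hj) (by simp)]

lemma stdSimplex.exists_pos_of_ne_vertex [DecidableEq I] {r : stdSimplex ℝ I} {i : I}
    (h : r ≠ stdSimplex.vertex i) : ∃ j, j ≠ i ∧ 0 < r.1 j := by
  by_contra! hc
  exact h (eq_vertex_of_forall_eq_zero fun j hj => le_antisymm (hc j hj) (r.2.1 j))

lemma stdSimplex.exists_pos (r : stdSimplex ℝ I) : ∃ j, 0 < r.1 j := by
  by_contra! hc
  have := Finset.sum_nonpos fun j (_ : j ∈ Finset.univ) => hc j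
  linarith [r.2.2]

lemma stdSimplex.sum_ofReal_mul (q : stdSimplex ℝ I) (K : ℝ≥0∞) :
    ∑ i, ENNReal.ofReal (q.1 i) * K = K := by
  rw [← Finset.sum_mul, ← ENNReal.ofReal_sum_of_nonneg fun i _ => q.2.1 i, q.2.2,
    ENNReal.ofReal_one, one_mul]

lemma klVec_vertex_eq_top [DecidableEq I] [MeasurableSpace I] [MeasurableSingletonClass I]
    {r : stdSimplex ℝ I} {i : I} (h : r ≠ stdSimplex.vertex i) :
    klVec r.1 (stdSimplex.vertex i : stdSimplex ℝ I).1 = ∞ := by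
  obtain ⟨j, hj, hpos⟩ := stdSimplex.exists_pos_of_ne_vertex h
  exact klVec_eq_top hpos (by simp [hj])

end Simplex

/-! ### Distribution of histories -/

/-- Splits off the last round; this is the induction step for sums over histories. -/
lemma Hist.sum_succ {A O : Type} [Fintype A] [Fintype O] {n : ℕ} {M : Type*} [AddCommMonoid M]
    (F : Hist A O n → A × O → M) :
    ∑ x : Hist A O (n + 1), F (x.take n n.le_succ) (x (Fin.last n)) = ∑ h, ∑ z, F h z := by
  rw [← (Fin.snocEquiv fun _ : Fin (n + 1) => A × O).sum_comp, Fintype.sum_prod_type,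
    Finset.sum_comm]
  refine Finset.sum_congr rfl fun h _ => Finset.sum_congr rfl fun z _ => ?_
  have h1 : Hist.take (T := n + 1) (Fin.snocEquiv (fun _ : Fin (n + 1) => A × O) (z, h)) n
      n.le_succ = h := by
    funext s
    exact Fin.snoc_castSucc (α := fun _ : Fin (n + 1) => A × O) z h s
  rw [h1]
  congr 1
  exact Fin.snoc_last (α := fun _ : Fin (n + 1) => A × O) z h

namespace FiniteDMSO

variable {I A O : Type} [Fintype O] (B : FiniteDMSO I A O)

lemma law_nonneg (i : I) (a : A) (o : O) : 0 ≤ B.law i a o := (B.law_mem i a).1 o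

lemma sum_law (i : I) (a : A) : ∑ o, B.law i a o = 1 := (B.law_mem i a).2

variable [Fintype A]

lemma histProb_succ (p : HistRule A O A) (i : I) {n : ℕ} (x : Hist A O (n + 1)) :
    B.histProb p i x = B.histProb p i (x.take n n.le_succ) *
      ((p n (x.take n n.le_succ)).1 (x (Fin.last n)).1 *
        B.law i (x (Fin.last n)).1 (x (Fin.last n)).2) := by
  unfold histProb
  rw [Fin.prod_univ_castSucc]
  rfl

lemma histProb_nonneg (p : HistRule A O A) (i : I) {n : ℕ} (x : Hist A O n) :
    0 ≤ B.histProb p i x :=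
  Finset.prod_nonneg fun t _ => mul_nonneg ((p t _).2.1 _) (B.law_nonneg _ _ _)

lemma sum_step (i : I) (q : stdSimplex ℝ A) :
    ∑ z : A × O, q.1 z.1 * B.law i z.1 z.2 = 1 := by
  rw [Fintype.sum_prod_type]
  simp_rw [← Finset.mul_sum, B.sum_law, mul_one]
  exact q.2.2

lemma sum_histProb (p : HistRule A O A) (i : I) (n : ℕ) :
    ∑ x : Hist A O n, B.histProb p i x = 1 := by
  induction n with
  | zero => simp [histProb]
  | succ n ih =>
    simp_rw [histProb_succ]
    rw [Hist.sum_succ fun h z => B.histProb p i h * ((p n h).1 z.1 * B.law i z.1 z.2)]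
    simp_rw [← Finset.mul_sum, B.sum_step, mul_one, ih]

lemma histProb_take_pos (p : HistRule A O A) {i : I} {n : ℕ} {x : Hist A O n}
    (hx : 0 < B.histProb p i x) {t : ℕ} (ht : t ≤ n) : 0 < B.histProb p i (x.take t ht) := by
  refine (B.histProb_nonneg p i _).lt_of_ne' (Finset.prod_ne_zero_iff.2 fun s _ => ?_)
  exact Finset.prod_ne_zero_iff.1 hx.ne' (Fin.castLE ht s) (Finset.mem_univ _)

lemma arm_law_pos (p : HistRule A O A) {i : I} {n : ℕ} {x : Hist A O n}
    (hx : 0 < B.histProb p i x) (t : Fin n) :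
    0 < (p t (x.take t t.isLt.le)).1 (x t).1 ∧ 0 < B.law i (x t).1 (x t).2 := by
  have h := Finset.prod_ne_zero_iff.1 hx.ne' t (Finset.mem_univ _)
  exact ⟨((p t _).2.1 _).lt_of_ne' (left_ne_zero_of_mul h),
    (B.law_nonneg _ _ _).lt_of_ne' (right_ne_zero_of_mul h)⟩

lemma expectedRegret_le_of_forall {p : HistRule A O A} {i : I} {T : ℕ} {a : A} {c : ℝ}
    (h : ∀ x : Hist A O T, 0 < B.histProb p i x →
      ∑ t, (B.value i a - B.value i (x t).1) ≤ c) : B.expectedRegret p i T a ≤ c := by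
  calc B.expectedRegret p i T a ≤ ∑ x : Hist A O T, B.histProb p i x * c := by
        refine Finset.sum_le_sum fun x _ => ?_
        rcases (B.histProb_nonneg p i x).eq_or_lt with h0 | h0
        · simp [← h0]
        · exact mul_le_mul_of_nonneg_left (h x h0) h0.le
    _ = c := by rw [← Finset.sum_mul, B.sum_histProb, one_mul]

/-- The affinity of the laws of the histories under two models is multiplicative when every round
has the same affinity. -/
lemma sum_sqrt_histProb {p : HistRule A O A} {i j : I} {β : ℝ}
    (h : ∀ (t : ℕ) (x : Hist A O t), 0 < B.histProb p i x →
      ∑ a, (p t x).1 a * ∑ o, √(B.law i a o * B.law j a o) = β) (n : ℕ) :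
    ∑ x : Hist A O n, √(B.histProb p i x * B.histProb p j x) = β ^ n := by
  induction n with
  | zero => simp [histProb]
  | succ n ih =>
    have hs : ∀ x : Hist A O (n + 1), √(B.histProb p i x * B.histProb p j x) =
        √(B.histProb p i (x.take n n.le_succ) * B.histProb p j (x.take n n.le_succ)) *
          ((p n (x.take n n.le_succ)).1 (x (Fin.last n)).1 *
            √(B.law i (x (Fin.last n)).1 (x (Fin.last n)).2 *
              B.law j (x (Fin.last n)).1 (x (Fin.last n)).2)) := by
      intro x
      have hp := (p n (x.take n n.le_succ)).2.1 (x (Fin.last n)).1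
      rw [B.histProb_succ, B.histProb_succ]
      rw [show ∀ u v q k l : ℝ, u * (q * k) * (v * (q * l)) = (u * v) * (q ^ 2 * (k * l)) by
        intros; ring, Real.sqrt_mul (mul_nonneg (B.histProb_nonneg _ _ _)
          (B.histProb_nonneg _ _ _)), Real.sqrt_mul (sq_nonneg _), Real.sqrt_sq hp]
    simp_rw [hs]
    rw [Hist.sum_succ fun h z => √(B.histProb p i h * B.histProb p j h) *
      ((p n h).1 z.1 * √(B.law i z.1 z.2 * B.law j z.1 z.2)), pow_succ, ← ih, Finset.sum_mul]
    refine Finset.sum_congr rfl fun x _ => ?_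
    rw [← Finset.mul_sum]
    -- The one-round affinity is known only on histories possible under `i`; the others contribute
    -- zero.
    rcases (B.histProb_nonneg p i x).eq_or_lt with h0 | h0
    · simp [← h0]
    · rw [Fintype.sum_prod_type]
      simp_rw [← Finset.mul_sum]
      rw [h n x h0]

end FiniteDMSO

/-! ### Optimistic E2D -/

namespace FiniteDMSO

section Optimistic

variable {I A O : Type} [Fintype I] [Fintype A] [Fintype O] (B : FiniteDMSO I A O) (η : ℝ)
  (ρ : stdSimplex ℝ I)

/-- Linearity in `ν` reduces the inner maximum to the finitely many vertices, which gives both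
continuity in `p` and explicit comparisons. -/
lemma optimisticObj_eq_sum [DecidableEq I] (p : stdSimplex ℝ A) (ν : stdSimplex ℝ I) :
    B.optimisticObj η ρ p ν =
      ∑ m, ν.1 m * B.optimisticObj η ρ p (stdSimplex.vertex m) := by
  have h : ∀ m, B.optimisticObj η ρ p (stdSimplex.vertex m) = ∑ a, p.1 a * ∑ φ, ρ.1 φ *
      (B.optValue φ - B.value m a - 1 / η * B.meanDiv a φ m) := by
    intro m
    simp [optimisticObj, Pi.single_apply]
  simp_rw [h, optimisticObj, Finset.mul_sum]
  rw [Finset.sum_comm (s := (Finset.univ : Finset I))]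
  refine Finset.sum_congr rfl fun a _ => ?_
  rw [Finset.sum_comm]
  exact Finset.sum_congr rfl fun m _ => Finset.sum_congr rfl fun φ _ => by ring

lemma iSup_optimisticObj [DecidableEq I] [Nonempty I] (p : stdSimplex ℝ A) :
    ⨆ ν, B.optimisticObj η ρ p ν = ⨆ m, B.optimisticObj η ρ p (stdSimplex.vertex m) := by
  have hle : ∀ ν, B.optimisticObj η ρ p ν ≤
      ⨆ m, B.optimisticObj η ρ p (stdSimplex.vertex m) := by
    intro ν
    rw [optimisticObj_eq_sum]
    calc _ ≤ ∑ m, ν.1 m * ⨆ m, B.optimisticObj η ρ p (stdSimplex.vertex m) :=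
          Finset.sum_le_sum fun m _ => mul_le_mul_of_nonneg_left
            (le_ciSup (f := fun m => B.optimisticObj η ρ p (stdSimplex.vertex m))
              (Set.finite_range _).bddAbove m) (ν.2.1 m)
      _ = _ := by rw [← Finset.sum_mul, ν.2.2, one_mul]
  refine le_antisymm (ciSup_le hle) (ciSup_le fun m => ?_)
  exact le_ciSup (f := fun ν => B.optimisticObj η ρ p ν)
    ⟨_, Set.forall_mem_range.2 hle⟩ (stdSimplex.vertex m)

lemma exists_minimax [Nonempty I] [Nonempty A] :
    ∃ p : stdSimplex ℝ A, ∀ p' : stdSimplex ℝ A,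
      (⨆ ν, B.optimisticObj η ρ p ν) ≤ ⨆ ν, B.optimisticObj η ρ p' ν := by
  classical
  have : CompactSpace (stdSimplex ℝ A) := isCompact_iff_compactSpace.1 (isCompact_stdSimplex ℝ A)
  have hc : Continuous fun p => ⨆ ν, B.optimisticObj η ρ p ν := by
    simp_rw [iSup_optimisticObj, ← Finset.sup'_univ_eq_ciSup]
    refine Continuous.finset_sup'_apply _ fun m _ => ?_
    unfold optimisticObj
    refine continuous_finsetSum _ fun a _ => Continuous.mul ?_ continuous_const
    exact (continuous_apply a).comp continuous_subtype_val
  obtain ⟨p, -, hp⟩ := isCompact_univ.exists_isMinOn Set.univ_nonempty hc.continuousOn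
  exact ⟨p, fun p' => hp (Set.mem_univ p')⟩

theorem exists_isOptimisticE2D [Nonempty I] [Nonempty A] (τ : ℕ) (ρ : HistRule A O I) :
    ∃ p, B.IsOptimisticE2D η τ ρ p := by
  classical
  choose P hP using fun ρ => B.exists_minimax η ρ
  -- Every `τ` divides `0`, so the first round always starts a batch and there is a previous arm
  -- whenever one must be repeated.
  refine ⟨fun t => match t with
    | 0 => fun h => P (ρ 0 h)
    | t + 1 => fun h => if τ ∣ t + 1 then P (ρ (t + 1) h) else
        stdSimplex.vertex (h (Fin.last t)).1, ?_, ?_⟩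
  · rintro (_ | t) h _ hd p'
    · exact hP _ _
    · simpa only [hd, if_true] using hP _ _
  · intro t h _ hd
    simp [hd]

end Optimistic

end FiniteDMSO

/-! ### The three-armed bandit -/

section ThreeArm

lemma gap_pos {T : ℕ} (hT : 1 ≤ T) : 0 < gap T := by
  have : (0 : ℝ) < T := by exact_mod_cast hT
  unfold gap
  positivity

lemma gap_le {T : ℕ} (hT : 1 ≤ T) : gap T ≤ 1 / 16 := by
  have h : (1 : ℝ) ≤ √(T : ℝ) := Real.one_le_sqrt.2 (by exact_mod_cast hT)
  exact one_div_le_one_div_of_le (by norm_num) (by linarith)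

lemma gap_mul_sqrt {T : ℕ} (hT : 1 ≤ T) : gap T * √(T : ℝ) = 1 / 16 := by
  have : (0 : ℝ) < T := by exact_mod_cast hT
  unfold gap
  field_simp

lemma threeArm_value (T : ℕ) (ε : ℝ) :
    (threeArm T ε).value = ![![1 / 2 - gap T, 1 / 2 + gap T, ε / 2],
      ![1 / 2 + gap T, 1 / 2 - gap T, ε / 2]] := by
  funext i a
  fin_cases i <;> fin_cases a <;>
    simp [FiniteDMSO.value, threeArm, threeArmLaw, berReward, Fin.sum_univ_four] <;> ring

lemma threeArm_optValue {T : ℕ} {ε : ℝ} (hT : 1 ≤ T) (hε : ε < gap T) (i : Fin 2) :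
    (threeArm T ε).optValue i = 1 / 2 + gap T := by
  have h0 := gap_pos hT
  have h1 := gap_le hT
  have hb : BddAbove (Set.range fun a => (threeArm T ε).value i a) :=
    (Set.finite_range _).bddAbove
  unfold FiniteDMSO.optValue
  refine le_antisymm (ciSup_le fun a => ?_) ?_
  · rw [threeArm_value]
    fin_cases i <;> fin_cases a <;> simp <;> linarith
  · fin_cases i
    · refine le_trans (le_of_eq ?_) (le_ciSup hb 1)
      simp [threeArm_value]
    · refine le_trans (le_of_eq ?_) (le_ciSup hb 0)
      simp [threeArm_value]

variable {T : ℕ} {ε η : ℝ}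

/-- A solution of the min-max problem of optimistic E2D gives no mass to the third arm. -/
lemma minimax_third_eq_zero (hT : 1 ≤ T) (hε : ε < gap T) (hη : 0 < η)
    {ρ : stdSimplex ℝ (Fin 2)} {p : stdSimplex ℝ (Fin 3)}
    (hp : ∀ p' : stdSimplex ℝ (Fin 3), (⨆ ν, (threeArm T ε).optimisticObj η ρ p ν) ≤
      ⨆ ν, (threeArm T ε).optimisticObj η ρ p' ν) : p.1 2 = 0 := by
  by_contra hne
  have hpos : 0 < p.1 2 := (p.2.1 2).lt_of_ne' hne
  have h1 := gap_le hT
  have hsum := p.2.2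
  rw [Fin.sum_univ_three] at hsum
  have hρ := ρ.2.2
  rw [Fin.sum_univ_two] at hρ
  -- The equal split has mean reward `1/2` under either model, against `ε / 2` for the third arm.
  have hmem : ![p.1 0 + p.1 2 / 2, p.1 1 + p.1 2 / 2, 0] ∈ stdSimplex ℝ (Fin 3) := by
    refine ⟨fun a => ?_, ?_⟩
    · have := p.2.1 0
      have := p.2.1 1
      fin_cases a <;> simp <;> linarith
    · simp [Fin.sum_univ_three]
      linarith
  have key := hp ⟨_, hmem⟩
  rw [FiniteDMSO.iSup_optimisticObj, FiniteDMSO.iSup_optimisticObj] at key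
  -- At a worst model for the modified distribution, both distributions are compared under the same
  -- model.
  obtain ⟨m, hm⟩ := exists_eq_ciSup_of_finite (f := fun m =>
    (threeArm T ε).optimisticObj η ρ ⟨_, hmem⟩ (stdSimplex.vertex m))
  rw [← hm] at key
  have hle := (le_ciSup (f := fun m => (threeArm T ε).optimisticObj η ρ p (stdSimplex.vertex m))
    (Set.finite_range _).bddAbove m).trans key
  have h4 : 0 ≤ p.1 2 * (η⁻¹ * (gap T) ^ 2) := by positivity
  have h5 : p.1 2 * ε < p.1 2 * (1 / 16) := mul_lt_mul_of_pos_left (by linarith) hpos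
  have h6 := mul_nonneg (ρ.2.1 0) h4
  have h7 := mul_nonneg (ρ.2.1 1) h4
  have hρ1 : ρ.1 1 = 1 - ρ.1 0 := by linarith
  fin_cases m <;>
  · simp [FiniteDMSO.optimisticObj, threeArm_optValue hT hε, Fin.sum_univ_three,
      FiniteDMSO.meanDiv, threeArm_value, hρ1] at hle
    rw [hρ1] at h7
    ring_nf at hle h4 h5 h6 h7
    nlinarith

lemma arm_ne_of_forall_reachable {I A O : Type} [Fintype A] [Fintype O]
    {B : FiniteDMSO I A O} {p : HistRule A O A} {b : A}
    (h : ∀ (t : ℕ) (x : Hist A O t), B.Reachable p x → (p t x).1 b = 0) {i : I} {n : ℕ}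
    {x : Hist A O n} (hx : 0 < B.histProb p i x) (t : Fin n) : (x t).1 ≠ b := by
  intro hb
  have h1 := (B.arm_law_pos p hx t).1
  rw [hb, h t _ ⟨i, B.histProb_take_pos p hx t.isLt.le⟩] at h1
  exact lt_irrefl _ h1

/-- Optimistic E2D never gives mass to the third arm. -/
lemma optimisticE2D_third_eq_zero (hT : 1 ≤ T) (hε : ε < gap T) (hη : 0 < η) {τ : ℕ}
    {ρ : HistRule (Fin 3) (Fin 4) (Fin 2)} {p : HistRule (Fin 3) (Fin 4) (Fin 3)}
    (hp : (threeArm T ε).IsOptimisticE2D η τ ρ p) (t : ℕ) :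
    ∀ x : Hist (Fin 3) (Fin 4) t, (threeArm T ε).Reachable p x → (p t x).1 2 = 0 := by
  induction t with
  | zero =>
    intro x hx
    exact minimax_third_eq_zero hT hε hη (hp.minimax 0 x hx (dvd_zero τ))
  | succ t ih =>
    intro x hx
    by_cases hd : τ ∣ t + 1
    · exact minimax_third_eq_zero hT hε hη (hp.minimax _ x hx hd)
    · obtain ⟨i, hi⟩ := hx
      have hb := ((threeArm T ε).arm_law_pos p hi (Fin.last t)).1
      have h2 : (x (Fin.last t)).1 ≠ 2 := by
        intro h2
        rw [h2] at hb
        exact hb.ne' (ih _ ⟨i, (threeArm T ε).histProb_take_pos p hi t.le_succ⟩)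
      rw [stdSimplex.eq_vertex_of_apply_eq_one (hp.batch t x ⟨i, hi⟩ hd)]
      simp [h2.symm]

/-! ### Two-point lower bound for learners that avoid the third arm -/

/-- For `a ≤ b`, AM-GM gives `√(ab) ≤ a + b/4`. The correction is linear, so over two probability
laws it sums to `1/2`, and the affinity bounds the overlap `∑ min` from below. -/
lemma sqrt_mul_sub_le_min {a b : ℝ} (ha : 0 ≤ a) (hb : 0 ≤ b) :
    √(a * b) - (a + b) / 4 ≤ min a b := by
  wlog hab : a ≤ b generalizing a b
  · rw [mul_comm, add_comm, min_comm]
    exact this hb ha (le_of_not_ge hab)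
  have h : √(a * b) ≤ a + b / 4 := by
    refine Real.sqrt_le_iff.2 ⟨by linarith, ?_⟩
    nlinarith [sq_nonneg (a - b / 4)]
  rw [min_eq_left hab]
  linarith

lemma sum_sqrt_threeArmLaw (hT : 1 ≤ T) {a : Fin 3} (ha : a ≠ 2) :
    ∑ o, √((threeArm T ε).law 0 a o * (threeArm T ε).law 1 a o) = √(1 - 4 * gap T ^ 2) := by
  have h0 := gap_pos hT
  have h1 := gap_le hT
  have h : √((1 / 2 - gap T) * (1 / 2 + gap T)) = √(1 - 4 * gap T ^ 2) / 2 := by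
    rw [show (1 / 2 - gap T) * (1 / 2 + gap T) = (1 - 4 * gap T ^ 2) / 2 ^ 2 by ring,
      Real.sqrt_div (by nlinarith), Real.sqrt_sq (by norm_num)]
  have h' : √((1 / 2 + gap T) * (1 / 2 - gap T)) = √(1 - 4 * gap T ^ 2) / 2 := by
    rw [mul_comm, h]
  have e1 : 1 - (1 / 2 - gap T) = 1 / 2 + gap T := by ring
  have e2 : 1 - (1 / 2 + gap T) = 1 / 2 - gap T := by ring
  fin_cases a
  · simp only [threeArm, threeArmLaw, berReward, Fin.sum_univ_four]
    simp [-one_div, e1, e2, h, h']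
  · simp only [threeArm, threeArmLaw, berReward, Fin.sum_univ_four]
    simp [-one_div, e1, e2, h, h']
  · exact absurd rfl ha

/-- A learner that never pulls the third arm has regret of order `√T` under one of the models. -/
lemma exists_regret_ge (hT : 1 ≤ T) {p : HistRule (Fin 3) (Fin 4) (Fin 3)}
    (hp : ∀ (t : ℕ) (x : Hist (Fin 3) (Fin 4) t), (threeArm T ε).Reachable p x →
      (p t x).1 2 = 0) :
    ∃ i : Fin 2, 1 / 64 * √(T : ℝ) ≤ ⨆ a, (threeArm T ε).expectedRegret p i T a := by
  set B := threeArm T ε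
  have h0 := gap_pos hT
  have h1 := gap_le hT
  have hsq : (T : ℝ) = √(T : ℝ) * √(T : ℝ) := (Real.mul_self_sqrt (Nat.cast_nonneg T)).symm
  have hgs := gap_mul_sqrt hT
  have hTg : (T : ℝ) * gap T = √(T : ℝ) / 16 := by
    linear_combination gap T * hsq + √(T : ℝ) * hgs
  have hTg2 : (T : ℝ) * gap T ^ 2 = 1 / 256 := by
    linear_combination gap T ^ 2 * hsq + (gap T * √(T : ℝ) + 1 / 16) * hgs
  have hS : 63 / 64 ≤ ∑ x : Hist (Fin 3) (Fin 4) T, √(B.histProb p 0 x * B.histProb p 1 x) := by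
    have hβ : ∀ (t : ℕ) (x : Hist (Fin 3) (Fin 4) t), 0 < B.histProb p 0 x →
        ∑ a, (p t x).1 a * ∑ o, √(B.law 0 a o * B.law 1 a o) = √(1 - 4 * gap T ^ 2) := by
      intro t x hx
      have hs := (p t x).2.2
      rw [Fin.sum_univ_three, hp t x ⟨0, hx⟩] at hs ⊢
      rw [sum_sqrt_threeArmLaw hT (by decide), sum_sqrt_threeArmLaw hT (by decide)]
      linear_combination √(1 - 4 * gap T ^ 2) * hs
    rw [B.sum_sqrt_histProb hβ]
    -- `1 - y ≤ √(1 - y)` on `[0, 1]`; Bernoulli's inequality and `TΔ² = 1/256` then give `1 -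
    -- 4/256`.
    have hle : 1 + -(4 * gap T ^ 2) ≤ √(1 - 4 * gap T ^ 2) :=
      Real.le_sqrt_of_sq_le (by nlinarith)
    calc (63 / 64 : ℝ) = 1 + T * -(4 * gap T ^ 2) := by linear_combination 4 * hTg2
      _ ≤ (1 + -(4 * gap T ^ 2)) ^ T := one_add_mul_le_pow (by nlinarith) T
      _ ≤ _ := pow_le_pow_left₀ (by nlinarith) hle T
  -- The constant is `2TΔ · (63/64 - 1/2) = (√T / 8) · (31/64)`.
  have hsum : 31 / 512 * √(T : ℝ) ≤ B.expectedRegret p 0 T 1 + B.expectedRegret p 1 T 0 := by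
    have hx : ∀ x : Hist (Fin 3) (Fin 4) T,
        2 * (T * gap T) * (√(B.histProb p 0 x * B.histProb p 1 x)
          - (B.histProb p 0 x + B.histProb p 1 x) / 4) ≤
        B.histProb p 0 x * ∑ t, (B.value 0 1 - B.value 0 (x t).1) +
          B.histProb p 1 x * ∑ t, (B.value 1 0 - B.value 1 (x t).1) := by
      intro x
      have hP0 := B.histProb_nonneg p 0 x
      have hP1 := B.histProb_nonneg p 1 x
      by_cases hz : ∃ t, (x t).1 = 2
      -- Such a history has probability zero under both models, so its possibly large regret is
      -- irrelevant.
      · obtain ⟨t, ht⟩ := hz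
        have hzero : ∀ i, B.histProb p i x = 0 := fun i => by
          by_contra hne
          exact arm_ne_of_forall_reachable hp ((B.histProb_nonneg p i x).lt_of_ne' hne) t ht
        simp [hzero]
      · push Not at hz
        have hterm : ∀ t, 0 ≤ B.value 0 1 - B.value 0 (x t).1 ∧
            0 ≤ B.value 1 0 - B.value 1 (x t).1 ∧
            (B.value 0 1 - B.value 0 (x t).1) + (B.value 1 0 - B.value 1 (x t).1) =
              2 * gap T := by
          intro t
          have ht := hz t
          simp only [B, threeArm_value]
          generalize (x t).1 = a at ht
          fin_cases a
          · simp; constructor <;> linarith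
          · simp; constructor <;> linarith
          · exact absurd rfl ht
        have hu : 0 ≤ ∑ t, (B.value 0 1 - B.value 0 (x t).1) :=
          Finset.sum_nonneg fun t _ => (hterm t).1
        have hv : 0 ≤ ∑ t, (B.value 1 0 - B.value 1 (x t).1) :=
          Finset.sum_nonneg fun t _ => (hterm t).2.1
        have huv : ∑ t, (B.value 0 1 - B.value 0 (x t).1) +
            ∑ t, (B.value 1 0 - B.value 1 (x t).1) = 2 * (T * gap T) := by
          rw [← Finset.sum_add_distrib, Finset.sum_congr rfl fun t _ => (hterm t).2.2]
          simp
          ring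
        rw [← huv, add_mul]
        have hm := sqrt_mul_sub_le_min hP0 hP1
        have ha := mul_le_mul_of_nonneg_left (hm.trans (min_le_left _ _)) hu
        have hb := mul_le_mul_of_nonneg_left (hm.trans (min_le_right _ _)) hv
        linarith
    unfold FiniteDMSO.expectedRegret
    rw [← Finset.sum_add_distrib]
    refine le_trans ?_ (Finset.sum_le_sum fun x _ => hx x)
    rw [← Finset.mul_sum, Finset.sum_sub_distrib, ← Finset.sum_div, Finset.sum_add_distrib,
      B.sum_histProb, B.sum_histProb, hTg]
    nlinarith [Real.sqrt_nonneg (T : ℝ)]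
  have hbdd : ∀ i, BddAbove (Set.range fun a => B.expectedRegret p i T a) := fun i =>
    (Set.finite_range _).bddAbove
  have hge0 := le_ciSup (hbdd 0) 1
  have hge1 := le_ciSup (hbdd 1) 0
  have hs := Real.sqrt_nonneg (T : ℝ)
  rcases le_total (31 / 1024 * √(T : ℝ)) (B.expectedRegret p 0 T 1) with h | h
  · exact ⟨0, by linarith⟩
  · exact ⟨1, by linarith⟩

end ThreeArm

/-! ### E2D with dual information gain -/

namespace FiniteDMSO

section Gain

variable {I A O : Type} [Fintype O] (B : FiniteDMSO I A O)

lemma sum_ofReal_law_mul (m : I) (a : A) (K : ℝ≥0∞) :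
    ∑ o, ENNReal.ofReal (B.law m a o) * K = K :=
  stdSimplex.sum_ofReal_mul ⟨B.law m a, B.law_mem m a⟩ K

section

variable [Finite A]

lemma value_le_optValue (i : I) (a : A) : B.value i a ≤ B.optValue i :=
  le_ciSup (f := fun a => B.value i a) (Set.finite_range _).bddAbove a

lemma exists_value_eq_optValue [Nonempty A] (i : I) : ∃ a, B.value i a = B.optValue i :=
  exists_eq_ciSup_of_finite (f := fun a => B.value i a)

end

variable [Fintype I]

lemma posterior_eq_vertex [DecidableEq I] {ν : stdSimplex ℝ I} {a : A} {o : O} {i : I}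
    (hν : 0 < ν.1 i) (hl : 0 < B.law i a o) (h : ∀ j, j ≠ i → ν.1 j * B.law j a o = 0) :
    B.posterior ν a o = (stdSimplex.vertex i : stdSimplex ℝ I).1 := by
  have hs : ∑ m, ν.1 m * B.law m a o = ν.1 i * B.law i a o :=
    Finset.sum_eq_single i (fun j _ hj => h j hj) (by simp)
  funext j
  rw [posterior, hs]
  rcases eq_or_ne j i with rfl | hj
  · simp [(mul_pos hν hl).ne']
  · simp [h j hj, hj]

lemma posterior_vertex [DecidableEq I] {a : A} {o : O} {i : I} (hl : 0 < B.law i a o) :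
    B.posterior (stdSimplex.vertex i) a o = (stdSimplex.vertex i : stdSimplex ℝ I).1 :=
  B.posterior_eq_vertex (by simp) hl fun j hj => by simp [hj]

variable [MeasurableSpace I]

/-- The belief update concentrates on a posterior that is a point mass. -/
lemma updateObj_minimal_iff [DecidableEq I] [MeasurableSingletonClass I]
    {ν ρ : HistRule A O I} {t : ℕ} {h : Hist A O (t + 1)} {i : I}
    (hpost : B.posterior (ν t (h.take t t.le_succ)) (h (Fin.last t)).1 (h (Fin.last t)).2 =
      (stdSimplex.vertex i : stdSimplex ℝ I).1)
    (hρ : klVec (stdSimplex.vertex i : stdSimplex ℝ I).1 (ρ t (h.take t t.le_succ)).1 ≠ ∞)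
    {s : stdSimplex ℝ I} :
    (∀ r, B.updateObj ν ρ h s ≤ B.updateObj ν ρ h r) ↔ s = stdSimplex.vertex i := by
  have htop : ∀ r, r ≠ stdSimplex.vertex i → B.updateObj ν ρ h r = ⊤ := by
    intro r hr
    rw [updateObj, hpost, klVec_vertex_eq_top hr, top_add, EReal.coe_ennreal_top,
      EReal.coe_add_top]
  -- Without a finite value at the point mass, every belief would be a minimiser.
  have hlt : B.updateObj ν ρ h (stdSimplex.vertex i) < ⊤ := by
    rw [updateObj, hpost, klVec_self, zero_add]
    refine EReal.add_lt_top (EReal.coe_ne_top _) ?_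
    rw [ne_eq, EReal.coe_ennreal_eq_top_iff]
    exact ENNReal.mul_ne_top ENNReal.ofReal_ne_top hρ
  constructor
  · intro hs
    by_contra hne
    have := (hs (stdSimplex.vertex i)).trans_lt hlt
    rw [htop s hne] at this
    exact lt_irrefl _ this
  · rintro rfl r
    by_cases hr : r = stdSimplex.vertex i
    · rw [hr]
    · rw [htop r hr]
      exact le_top

variable [Fintype A]

/-- The gain is an average with weights `p`, `ν` and the laws; only triples of positive weight
matter, where the posterior is not a `0 / 0`. -/
lemma infoGain_le {ρ ν : stdSimplex ℝ I} {p : stdSimplex ℝ A} {K : A → ℝ≥0∞}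
    (h : ∀ a m o, 0 < p.1 a → 0 < ν.1 m → 0 < B.law m a o →
      klVec (B.posterior ν a o) ρ.1 ≤ K a) :
    B.infoGain ρ p ν ≤ ∑ a, ENNReal.ofReal (p.1 a) * K a := by
  refine Finset.sum_le_sum fun a _ => ?_
  rcases (p.2.1 a).eq_or_lt with ha | ha
  · simp [← ha]
  refine mul_le_mul_right ?_ _
  calc _ ≤ ∑ m, ENNReal.ofReal (ν.1 m) * ∑ o, ENNReal.ofReal (B.law m a o) * K a := by
        refine Finset.sum_le_sum fun m _ => ?_
        rcases (ν.2.1 m).eq_or_lt with hm | hm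
        · simp [← hm]
        refine mul_le_mul_right (Finset.sum_le_sum fun o _ => ?_) _
        rcases (B.law_nonneg m a o).eq_or_lt with ho | ho
        · simp [← ho]
        exact mul_le_mul_right (h a m o ha hm ho) _
    _ = K a := by
        simp_rw [B.sum_ofReal_law_mul, stdSimplex.sum_ofReal_mul]

lemma infoGain_eq {ρ ν : stdSimplex ℝ I} {p : stdSimplex ℝ A} {K : ℝ≥0∞}
    (h : ∀ a m o, 0 < p.1 a → 0 < ν.1 m → 0 < B.law m a o →
      klVec (B.posterior ν a o) ρ.1 = K) : B.infoGain ρ p ν = K := by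
  have hc : B.infoGain ρ p ν = ∑ a, ENNReal.ofReal (p.1 a) * ∑ m, ENNReal.ofReal (ν.1 m) *
      ∑ o, ENNReal.ofReal (B.law m a o) * K := by
    refine Finset.sum_congr rfl fun a _ => ?_
    rcases (p.2.1 a).eq_or_lt with ha | ha
    · simp [← ha]
    congr 1
    refine Finset.sum_congr rfl fun m _ => ?_
    rcases (ν.2.1 m).eq_or_lt with hm | hm
    · simp [← hm]
    congr 1
    refine Finset.sum_congr rfl fun o _ => ?_
    rcases (B.law_nonneg m a o).eq_or_lt with ho | ho
    · simp [← ho]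
    rw [h a m o ha hm ho]
  rw [hc]
  simp_rw [B.sum_ofReal_law_mul, stdSimplex.sum_ofReal_mul]

lemma infoGain_vertex_self [DecidableEq I] (p : stdSimplex ℝ A) (i : I) :
    B.infoGain (stdSimplex.vertex i) p (stdSimplex.vertex i) = 0 := by
  refine B.infoGain_eq fun a m o _ hm hl => ?_
  obtain rfl := stdSimplex.eq_of_vertex_pos hm
  rw [B.posterior_vertex hl, klVec_self]

/-- A model `j ≠ i` charged by `ν` keeps positive posterior mass after any observation it can
produce. -/
lemma infoGain_vertex_eq_top [DecidableEq I] [MeasurableSingletonClass I] {ν : stdSimplex ℝ I}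
    {i : I} (hν : ν ≠ stdSimplex.vertex i) (p : stdSimplex ℝ A) :
    B.infoGain (stdSimplex.vertex i) p ν = ∞ := by
  obtain ⟨a, ha⟩ := stdSimplex.exists_pos p
  obtain ⟨j, hj, hνj⟩ := stdSimplex.exists_pos_of_ne_vertex hν
  obtain ⟨o, ho⟩ := stdSimplex.exists_pos ⟨B.law j a, B.law_mem j a⟩
  have hpos : 0 < B.posterior ν a o j := by
    have hm := mul_pos hνj ho
    refine div_pos hm (hm.trans_le ?_)
    exact Finset.single_le_sum (f := fun m => ν.1 m * B.law m a o)
      (fun m _ => mul_nonneg (ν.2.1 m) (B.law_nonneg m a o)) (Finset.mem_univ j)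
  have htop : klVec (B.posterior ν a o) (stdSimplex.vertex i : stdSimplex ℝ I).1 = ∞ :=
    klVec_eq_top hpos (by simp [hj])
  refine ENNReal.sum_eq_top.2 ⟨a, Finset.mem_univ a, ?_⟩
  have h2 : ∑ o, ENNReal.ofReal (B.law j a o) *
      klVec (B.posterior ν a o) (stdSimplex.vertex i : stdSimplex ℝ I).1 = ∞ := by
    refine ENNReal.sum_eq_top.2 ⟨o, Finset.mem_univ o, ?_⟩
    rw [htop, ENNReal.mul_top (by simpa using ho)]
  rw [ENNReal.sum_eq_top.2 ⟨j, Finset.mem_univ j, ?_⟩, ENNReal.mul_top (by simpa using ha)]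
  rw [h2, ENNReal.mul_top (by simpa using hνj)]

/-- The reward and divergence part of the objective `air`. -/
noncomputable def airReward (η : ℝ) (ρ : stdSimplex ℝ I) (p : stdSimplex ℝ A)
    (ν : stdSimplex ℝ I) : ℝ :=
  ∑ a, p.1 a * ∑ m, ν.1 m * (B.optValue m - B.value m a
      - 1 / η * ∑ φ, ρ.1 φ * B.meanDiv a φ m)

variable {η : ℝ}

lemma air_eq_bot (hη : 0 < η) {ρ ν : stdSimplex ℝ I} {p : stdSimplex ℝ A}
    (h : B.infoGain ρ p ν = ∞) : B.air η ρ p ν = ⊥ := by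
  rw [air, h, ENNReal.mul_top (by simpa using hη)]
  simp

lemma air_eq_coe (hη : 0 < η) {ρ ν : stdSimplex ℝ I} {p : stdSimplex ℝ A} {x : ℝ}
    (hx : 0 ≤ x) (h : B.infoGain ρ p ν = ENNReal.ofReal x) :
    B.air η ρ p ν = ((B.airReward η ρ p ν - 1 / η * x : ℝ) : EReal) := by
  have hx' : 0 ≤ 1 / η * x := by positivity
  rw [air, h, ← ENNReal.ofReal_mul (by positivity), EReal.coe_ennreal_ofReal,
    max_eq_left hx', EReal.coe_sub]
  rfl

lemma coe_le_air (hη : 0 < η) {ρ ν : stdSimplex ℝ I} {p : stdSimplex ℝ A} {x : ℝ}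
    (hx : 0 ≤ x) (h : B.infoGain ρ p ν ≤ ENNReal.ofReal x) :
    ((B.airReward η ρ p ν - 1 / η * x : ℝ) : EReal) ≤ B.air η ρ p ν := by
  have hx' : 0 ≤ 1 / η * x := by positivity
  have h1 : ENNReal.ofReal (1 / η) * B.infoGain ρ p ν ≤ ENNReal.ofReal (1 / η * x) := by
    rw [ENNReal.ofReal_mul (by positivity)]
    exact mul_le_mul_right h _
  rw [EReal.coe_sub, air]
  refine EReal.sub_le_sub le_rfl ?_
  refine (EReal.coe_ennreal_le_coe_ennreal_iff.2 h1).trans ?_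
  rw [EReal.coe_ennreal_ofReal, max_eq_left hx']

lemma air_vertex_self [DecidableEq I] (hη : 0 < η) (p : stdSimplex ℝ A) (i : I) :
    B.air η (stdSimplex.vertex i) p (stdSimplex.vertex i) =
      ((∑ a, p.1 a * (B.optValue i - B.value i a) : ℝ) : EReal) := by
  rw [B.air_eq_coe hη le_rfl (by rw [infoGain_vertex_self, ENNReal.ofReal_zero])]
  simp [airReward, Pi.single_apply, meanDiv]

/-- If the belief is a point mass, then at a saddle point the adversary plays that mass and the
learner pulls optimal arms of the corresponding model. -/
lemma isSaddlePointOn_air_vertex_iff [DecidableEq I] [MeasurableSingletonClass I] [Nonempty A]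
    (hη : 0 < η) {i : I} {p : stdSimplex ℝ A} {ν : stdSimplex ℝ I} :
    IsSaddlePointOn Set.univ Set.univ (B.air η (stdSimplex.vertex i)) p ν ↔
      ν = stdSimplex.vertex i ∧ ∀ a, 0 < p.1 a → B.value i a = B.optValue i := by
  classical
  have hterm : ∀ (q : stdSimplex ℝ A) (a : A), 0 ≤ q.1 a * (B.optValue i - B.value i a) :=
    fun q a => mul_nonneg (q.2.1 a) (sub_nonneg.2 (B.value_le_optValue i a))
  constructor
  · intro h
    have hν : ν = stdSimplex.vertex i := by
      by_contra hne
      have h1 := h p (Set.mem_univ _) (stdSimplex.vertex i) (Set.mem_univ _)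
      rw [B.air_eq_bot hη (B.infoGain_vertex_eq_top hne p), B.air_vertex_self hη] at h1
      exact absurd h1 (not_le.2 (EReal.bot_lt_coe _))
    refine ⟨hν, fun a ha => ?_⟩
    obtain ⟨b, hb⟩ := B.exists_value_eq_optValue i
    -- Deviating to an optimal arm brings the value to `0`, while each term of the learner's own
    -- value is nonnegative.
    have h1 := h (stdSimplex.vertex b) (Set.mem_univ _) (stdSimplex.vertex i) (Set.mem_univ _)
    rw [hν, B.air_vertex_self hη, B.air_vertex_self hη, EReal.coe_le_coe_iff] at h1
    have h2 : ∑ a, (stdSimplex.vertex b : stdSimplex ℝ A).1 a *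
        (B.optValue i - B.value i a) = 0 := by
      simp [Pi.single_apply, hb]
    rw [h2] at h1
    have h3 := (Finset.single_le_sum (f := fun a => p.1 a * (B.optValue i - B.value i a))
      (fun a _ => hterm p a) (Finset.mem_univ a)).trans h1
    have h4 := B.value_le_optValue i a
    nlinarith
  · rintro ⟨rfl, hp⟩ q - μ -
    by_cases hμ : μ = stdSimplex.vertex i
    · rw [hμ, B.air_vertex_self hη, B.air_vertex_self hη, EReal.coe_le_coe_iff]
      refine le_trans (le_of_eq (Finset.sum_eq_zero fun a _ => ?_))
        (Finset.sum_nonneg fun a _ => hterm q a)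
      rcases (p.2.1 a).eq_or_lt with ha | ha
      · simp [← ha]
      · simp [hp a ha]
    · rw [B.air_eq_bot hη (B.infoGain_vertex_eq_top hμ p)]
      exact bot_le

end Gain

end FiniteDMSO

/-! ### Dual information gain on the three-armed bandit -/

section ThreeArm

variable {T : ℕ} {ε η : ℝ}

lemma klVec_vertex_barycenter (i : Fin 2) :
    klVec (stdSimplex.vertex i : stdSimplex ℝ (Fin 2)).1
      (stdSimplex.barycenter : stdSimplex ℝ (Fin 2)).1 = ENNReal.ofReal (Real.log 2) := by
  rw [klVec_eq_sum (stdSimplex.vertex i : stdSimplex ℝ (Fin 2)).2.1 (fun _ => by simp),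
    ← ENNReal.ofReal_sum_of_nonneg fun j _ => mul_nonneg (by simp)
      (InformationTheory.klFun_nonneg (div_nonneg
        ((stdSimplex.vertex i : stdSimplex ℝ (Fin 2)).2.1 j) (by simp))), Fin.sum_univ_two]
  congr 1
  fin_cases i <;> simp [InformationTheory.klFun_apply] <;> ring

/-- The third arm reveals the model. -/
lemma law_third_eq_zero {i j : Fin 2} {o : Fin 4} (h : 0 < (threeArm T ε).law i 2 o)
    (hj : j ≠ i) : (threeArm T ε).law j 2 o = 0 := by
  revert h
  fin_cases i <;> fin_cases j <;> fin_cases o <;> simp [threeArm, threeArmLaw] at hj ⊢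

lemma posterior_third {ν : stdSimplex ℝ (Fin 2)} {i : Fin 2} {o : Fin 4} (hν : 0 < ν.1 i)
    (h : 0 < (threeArm T ε).law i 2 o) :
    (threeArm T ε).posterior ν 2 o = (stdSimplex.vertex i : stdSimplex ℝ (Fin 2)).1 :=
  (threeArm T ε).posterior_eq_vertex hν h fun j hj => by rw [law_third_eq_zero h hj, mul_zero]

/-- From a uniform prior the posterior weights are `1/2 ± Δ`, so the chi-squared divergence is `2 ·
Δ² / (1/2)`. -/
lemma klVec_posterior_barycenter_le (hT : 1 ≤ T) {a : Fin 3} (ha : a ≠ 2) {m : Fin 2} {o : Fin 4}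
    (ho : 0 < (threeArm T ε).law m a o) :
    klVec ((threeArm T ε).posterior stdSimplex.barycenter a o)
      (stdSimplex.barycenter : stdSimplex ℝ (Fin 2)).1 ≤ ENNReal.ofReal (4 * gap T ^ 2) := by
  have h0 := gap_pos hT
  have h1 := gap_le hT
  have hlaw : ∀ i, 0 ≤ (threeArm T ε).law i a o := fun i => (threeArm T ε).law_nonneg i a o
  refine (klVec_le_chiSq (fun i => ?_) fun _ => by simp).trans (ENNReal.ofReal_le_ofReal ?_)
  · exact div_nonneg (mul_nonneg (by simp) (hlaw i))
      (Finset.sum_nonneg fun j _ => mul_nonneg (by simp) (hlaw j))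
  · refine le_of_eq ?_
    rw [Fin.sum_univ_two]
    unfold FiniteDMSO.posterior
    rw [Fin.sum_univ_two]
    revert ho
    fin_cases a
    · fin_cases m <;> fin_cases o <;> simp [threeArm, threeArmLaw, berReward] <;> intro _ <;>
        ring
    · fin_cases m <;> fin_cases o <;> simp [threeArm, threeArmLaw, berReward] <;> intro _ <;>
        ring
    · exact absurd rfl ha

/-- The third arm equalises: every posterior is a vertex and the mean divergence vanishes, so the
value does not depend on `ν`. -/
lemma air_third (hT : 1 ≤ T) (hε : ε < gap T) (hη : 0 < η) (ν : stdSimplex ℝ (Fin 2)) :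
    (threeArm T ε).air η stdSimplex.barycenter (stdSimplex.vertex 2) ν =
      ((1 / 2 + gap T - ε / 2 - 1 / η * Real.log 2 : ℝ) : EReal) := by
  rw [(threeArm T ε).air_eq_coe hη (Real.log_nonneg one_le_two)
    ((threeArm T ε).infoGain_eq fun a m o ha hm hl => ?_)]
  · have hν := ν.2.2
    rw [Fin.sum_univ_two] at hν
    norm_cast
    congr 1
    simp [FiniteDMSO.airReward, Pi.single_apply, FiniteDMSO.meanDiv, threeArm_value,
      threeArm_optValue hT hε]
    linear_combination (1 / 2 + gap T - ε / 2) * hν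
  · obtain rfl := stdSimplex.eq_of_vertex_pos ha
    rw [posterior_third hm hl, klVec_vertex_barycenter]

/-- The `6Δ²` is `4Δ²` of information plus the average `(2Δ)² / 2` of the mean divergence. -/
lemma le_air_barycenter (hT : 1 ≤ T) (hε : ε < gap T) (hη : 0 < η) (p : stdSimplex ℝ (Fin 3)) :
    (((p.1 0 + p.1 1) * (gap T - 1 / η * (6 * gap T ^ 2)) +
      p.1 2 * (1 / 2 + gap T - ε / 2 - 1 / η * Real.log 2) : ℝ) : EReal) ≤
    (threeArm T ε).air η stdSimplex.barycenter p stdSimplex.barycenter := by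
  have h0 := gap_pos hT
  have hlog : 0 ≤ Real.log 2 := Real.log_nonneg one_le_two
  have hp := p.2.1
  set K : Fin 3 → ℝ := ![4 * gap T ^ 2, 4 * gap T ^ 2, Real.log 2] with hK
  have hK0 : ∀ a, 0 ≤ K a := by
    intro a
    fin_cases a <;> simp [hK] <;> positivity
  have hle : (threeArm T ε).infoGain stdSimplex.barycenter p stdSimplex.barycenter ≤
      ENNReal.ofReal (∑ a, p.1 a * K a) := by
    rw [ENNReal.ofReal_sum_of_nonneg fun a _ => mul_nonneg (hp a) (hK0 a)]
    simp_rw [ENNReal.ofReal_mul (hp _)]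
    refine (threeArm T ε).infoGain_le fun a m o _ hm hl => ?_
    by_cases ha : a = 2
    · subst ha
      rw [posterior_third hm hl, klVec_vertex_barycenter]
      simp [hK]
    · refine (klVec_posterior_barycenter_le hT ha hl).trans (le_of_eq ?_)
      fin_cases a
      · simp [hK]
      · simp [hK]
      · exact absurd rfl ha
  refine le_trans (le_of_eq ?_) ((threeArm T ε).coe_le_air hη
    (Finset.sum_nonneg fun a _ => mul_nonneg (hp a) (hK0 a)) hle)
  congr 1
  simp [FiniteDMSO.airReward, FiniteDMSO.meanDiv, threeArm_value, threeArm_optValue hT hε,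
    Fin.sum_univ_three, hK]
  ring

/-- The information advantage of the third arm exceeds its cost `1/2 - ε/2` in reward; this is where
`η ≤ 1` enters. -/
lemma half_lt_log_sub (hT : 1 ≤ T) (hη : 0 < η) (hη1 : η ≤ 1) :
    1 / 2 < 1 / η * (Real.log 2 - 6 * gap T ^ 2) := by
  have h0 := gap_pos hT
  have h1 := gap_le hT
  have hl := Real.log_two_gt_d9
  have h3 : 1 / 2 < Real.log 2 - 6 * gap T ^ 2 := by nlinarith
  exact h3.trans_le (le_mul_of_one_le_left (by linarith) (one_le_one_div hη hη1))

/-- Against a point mass, an optimal arm gains less than the third arm. -/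
lemma exists_air_vertex_lt (hT : 1 ≤ T) (hε0 : 0 < ε) (hε : ε < gap T) (hη : 0 < η)
    (i : Fin 2) : ∃ p, (threeArm T ε).air η stdSimplex.barycenter p (stdSimplex.vertex i) <
      ((1 / 2 + gap T - ε / 2 - 1 / η * Real.log 2 : ℝ) : EReal) := by
  have h0 := gap_pos hT
  have h1 := gap_le hT
  obtain ⟨b, hb⟩ := (threeArm T ε).exists_value_eq_optValue i
  refine ⟨stdSimplex.vertex b, ?_⟩
  rw [(threeArm T ε).air_eq_coe hη (Real.log_nonneg one_le_two)
    ((threeArm T ε).infoGain_eq fun a m o _ hm hl => ?_)]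
  · rw [EReal.coe_lt_coe_iff]
    have hr : (threeArm T ε).airReward η stdSimplex.barycenter (stdSimplex.vertex b)
        (stdSimplex.vertex i) ≤ 0 := by
      have hD : 0 ≤ ∑ φ, (2 : ℝ)⁻¹ * (threeArm T ε).meanDiv b φ i :=
        Finset.sum_nonneg fun φ _ => mul_nonneg (by norm_num) (sq_nonneg _)
      have : 0 ≤ η⁻¹ * ∑ φ, (2 : ℝ)⁻¹ * (threeArm T ε).meanDiv b φ i := by positivity
      simpa [FiniteDMSO.airReward, Pi.single_apply, hb] using this
    linarith
  · obtain rfl := stdSimplex.eq_of_vertex_pos hm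
    rw [(threeArm T ε).posterior_vertex hl, klVec_vertex_barycenter]

lemma isSaddlePointOn_air_barycenter (hT : 1 ≤ T) (hε0 : 0 < ε) (hε : ε < gap T) (hη : 0 < η)
    (hη1 : η ≤ 1) :
    IsSaddlePointOn Set.univ Set.univ ((threeArm T ε).air η stdSimplex.barycenter)
      (stdSimplex.vertex 2) stdSimplex.barycenter := by
  intro p _ ν _
  refine le_trans ?_ (le_air_barycenter hT hε hη p)
  rw [air_third hT hε hη, EReal.coe_le_coe_iff]
  have hs := p.2.2
  rw [Fin.sum_univ_three] at hs
  have h2 := half_lt_log_sub hT hη hη1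
  have h3 : p.1 2 = 1 - (p.1 0 + p.1 1) := by linarith
  have h4 : 0 ≤ p.1 0 + p.1 1 := add_nonneg (p.2.1 0) (p.2.1 1)
  rw [h3]
  nlinarith [mul_nonneg h4 (sub_nonneg.2 h2.le), mul_nonneg h4 hε0.le]

/-- At a saddle point for the uniform belief, the learner pulls the third arm and the adversary
gives mass to both models. -/
lemma saddle_barycenter (hT : 1 ≤ T) (hε0 : 0 < ε) (hε : ε < gap T) (hη : 0 < η) (hη1 : η ≤ 1)
    {p : stdSimplex ℝ (Fin 3)} {ν : stdSimplex ℝ (Fin 2)}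
    (h : IsSaddlePointOn Set.univ Set.univ ((threeArm T ε).air η stdSimplex.barycenter) p ν) :
    p.1 2 = 1 ∧ ∀ i, 0 < ν.1 i := by
  have hs := p.2.2
  rw [Fin.sum_univ_three] at hs
  have h2 := half_lt_log_sub hT hη hη1
  have h4 : 0 ≤ p.1 0 + p.1 1 := add_nonneg (p.2.1 0) (p.2.1 1)
  have hp : p.1 2 = 1 := by
    -- Testing the saddle point against the third arm and the uniform `ν`: any mass on the first two
    -- arms would strictly raise the learner's value.
    have h5 := (le_air_barycenter hT hε hη p).trans
      (h (stdSimplex.vertex 2) (Set.mem_univ _) stdSimplex.barycenter (Set.mem_univ _))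
    rw [air_third hT hε hη, EReal.coe_le_coe_iff, show p.1 2 = 1 - (p.1 0 + p.1 1) by linarith]
      at h5
    have h6 : ¬ 0 < p.1 0 + p.1 1 := fun hpos => by
      nlinarith [mul_pos hpos (sub_pos.2 h2), mul_pos hpos hε0]
    linarith
  refine ⟨hp, fun i => (ν.2.1 i).lt_of_ne' fun hi => ?_⟩
  have hother : ∀ i : Fin 2, ∃ j, ∀ k, k ≠ j → k = i := by decide
  obtain ⟨j, hj⟩ := hother i
  -- With two models, a missing one makes `ν` a vertex; the optimal arm there has value at most
  -- `-log 2 / η`, a profitable deviation.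
  have hν : ν = stdSimplex.vertex j :=
    stdSimplex.eq_vertex_of_forall_eq_zero fun k hk => (hj k hk).symm ▸ hi
  obtain ⟨q, hq⟩ := exists_air_vertex_lt hT hε0 hε hη j
  have h5 := h q (Set.mem_univ _) stdSimplex.barycenter (Set.mem_univ _)
  rw [stdSimplex.eq_vertex_of_apply_eq_one hp, air_third hT hε hη, hν] at h5
  exact absurd hq (not_lt.2 h5)

lemma digE2D_init {B : FiniteDMSO (Fin 2) (Fin 3) (Fin 4)} {p : HistRule (Fin 3) (Fin 4) (Fin 3)}
    {ν ρ : HistRule (Fin 3) (Fin 4) (Fin 2)} (h : B.IsDigE2D η p ν ρ)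
    (x : Hist (Fin 3) (Fin 4) 0) : ρ 0 x = stdSimplex.barycenter :=
  Subtype.ext (funext fun φ => by rw [h.init, stdSimplex.barycenter_apply, one_div])

lemma digE2D_first_round (hT : 1 ≤ T) (hε0 : 0 < ε) (hε : ε < gap T) (hη : 0 < η) (hη1 : η ≤ 1)
    {p : HistRule (Fin 3) (Fin 4) (Fin 3)} {ν ρ : HistRule (Fin 3) (Fin 4) (Fin 2)}
    (h : (threeArm T ε).IsDigE2D η p ν ρ) (x : Hist (Fin 3) (Fin 4) 0) :
    (p 0 x).1 2 = 1 ∧ ∀ i, 0 < (ν 0 x).1 i := by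
  have hs := h.saddle 0 x ⟨0, by simp [FiniteDMSO.histProb]⟩
  rw [digE2D_init h] at hs
  exact saddle_barycenter hT hε0 hε hη hη1 hs

/-- After the first round the belief is the point mass at the true model. -/
lemma digE2D_belief (hT : 1 ≤ T) (hε0 : 0 < ε) (hε : ε < gap T) (hη : 0 < η) (hη1 : η ≤ 1)
    {p : HistRule (Fin 3) (Fin 4) (Fin 3)} {ν ρ : HistRule (Fin 3) (Fin 4) (Fin 2)}
    (h : (threeArm T ε).IsDigE2D η p ν ρ) (i : Fin 2) (t : ℕ) :
    ∀ x : Hist (Fin 3) (Fin 4) (t + 1), 0 < (threeArm T ε).histProb p i x →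
      ρ (t + 1) x = stdSimplex.vertex i := by
  induction t with
  | zero =>
    intro x hx
    obtain ⟨hp, hν⟩ := digE2D_first_round hT hε0 hε hη hη1 h (x.take 0 (Nat.le_succ 0))
    obtain ⟨ha, hl⟩ := (threeArm T ε).arm_law_pos p hx (Fin.last 0)
    have ha2 : (x (Fin.last 0)).1 = 2 := by
      change 0 < (p 0 (x.take 0 (Nat.le_succ 0))).1 (x (Fin.last 0)).1 at ha
      rw [stdSimplex.eq_vertex_of_apply_eq_one hp] at ha
      exact stdSimplex.eq_of_vertex_pos ha
    refine ((threeArm T ε).updateObj_minimal_iff ?_ ?_).1 (h.update 0 x ⟨i, hx⟩)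
    · rw [ha2] at hl ⊢
      exact posterior_third (hν i) hl
    · rw [digE2D_init h, klVec_vertex_barycenter]
      exact ENNReal.ofReal_ne_top
  | succ t ih =>
    intro x hx
    have hx' := (threeArm T ε).histProb_take_pos p hx (t + 1).le_succ
    have hρ := ih _ hx'
    have hs := h.saddle _ _ ⟨i, hx'⟩
    rw [hρ, (threeArm T ε).isSaddlePointOn_air_vertex_iff hη] at hs
    refine ((threeArm T ε).updateObj_minimal_iff ?_ ?_).1 (h.update _ x ⟨i, hx⟩)
    · rw [hs.1]
      exact (threeArm T ε).posterior_vertex ((threeArm T ε).arm_law_pos p hx (Fin.last _)).2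
    · rw [hρ, klVec_self]
      exact ENNReal.zero_ne_top

lemma digE2D_optimal (hT : 1 ≤ T) (hε0 : 0 < ε) (hε : ε < gap T) (hη : 0 < η) (hη1 : η ≤ 1)
    {p : HistRule (Fin 3) (Fin 4) (Fin 3)} {ν ρ : HistRule (Fin 3) (Fin 4) (Fin 2)}
    (h : (threeArm T ε).IsDigE2D η p ν ρ) {i : Fin 2} {t : ℕ}
    {x : Hist (Fin 3) (Fin 4) (t + 1)} (hx : 0 < (threeArm T ε).histProb p i x) {a : Fin 3}
    (ha : 0 < (p (t + 1) x).1 a) : (threeArm T ε).value i a = (threeArm T ε).optValue i := by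
  have hs := h.saddle _ _ ⟨i, hx⟩
  rw [digE2D_belief hT hε0 hε hη hη1 h i t x hx,
    (threeArm T ε).isSaddlePointOn_air_vertex_iff hη] at hs
  exact hs.2 a ha

lemma digE2D_regret_le (hT : 1 ≤ T) (hε0 : 0 < ε) (hε : ε < gap T) (hη : 0 < η) (hη1 : η ≤ 1)
    {p : HistRule (Fin 3) (Fin 4) (Fin 3)} {ν ρ : HistRule (Fin 3) (Fin 4) (Fin 2)}
    (h : (threeArm T ε).IsDigE2D η p ν ρ) (i : Fin 2) (a : Fin 3) :
    (threeArm T ε).expectedRegret p i T a ≤ 1 := by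
  obtain ⟨n, rfl⟩ : ∃ n, T = n + 1 := ⟨T - 1, by omega⟩
  have h1 := gap_le hT
  refine (threeArm (n + 1) ε).expectedRegret_le_of_forall fun x hx => ?_
  have hle := (threeArm (n + 1) ε).value_le_optValue i a
  rw [Fin.sum_univ_succ]
  have hfirst : (threeArm (n + 1) ε).value i a - (threeArm (n + 1) ε).value i (x 0).1 ≤ 1 := by
    have hnonneg : 0 ≤ (threeArm (n + 1) ε).value i (x 0).1 := by
      have h0 := gap_pos hT
      rw [threeArm_value]
      generalize (x 0).1 = b
      fin_cases i <;> fin_cases b <;> simp <;> linarith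
    rw [threeArm_optValue hT hε] at hle
    linarith
  have hrest : ∑ t : Fin n, ((threeArm (n + 1) ε).value i a -
      (threeArm (n + 1) ε).value i (x t.succ).1) ≤ 0 := by
    refine Finset.sum_nonpos fun t _ => ?_
    rw [digE2D_optimal hT hε0 hε hη hη1 h
      ((threeArm (n + 1) ε).histProb_take_pos p hx t.succ.isLt.le)
      ((threeArm (n + 1) ε).arm_law_pos p hx t.succ).1]
    linarith
  linarith

/-- The model under which the third arm can produce the first observation of the history. -/
def revealedModel {t : ℕ} (x : Hist (Fin 3) (Fin 4) (t + 1)) : Fin 2 :=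
  -- Observation `1` is the reward `ε / 2`, which the third arm yields only under the second model.
  if (x 0).2 = 1 then 1 else 0

lemma revealedModel_eq {t : ℕ} {x : Hist (Fin 3) (Fin 4) (t + 1)} {i : Fin 2}
    (h : 0 < (threeArm T ε).law i 2 (x 0).2) : revealedModel x = i := by
  unfold revealedModel
  revert h
  generalize (x 0).2 = o
  fin_cases i <;> fin_cases o <;> simp [threeArm, threeArmLaw]

theorem exists_isDigE2D (hT : 1 ≤ T) (hε0 : 0 < ε) (hε : ε < gap T) (hη : 0 < η) (hη1 : η ≤ 1) :
    ∃ p ν ρ, (threeArm T ε).IsDigE2D η p ν ρ := by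
  choose best hbest using (threeArm T ε).exists_value_eq_optValue
  let p : HistRule (Fin 3) (Fin 4) (Fin 3) := fun t => match t with
    | 0 => fun _ => stdSimplex.vertex 2
    | _ + 1 => fun x => stdSimplex.vertex (best (revealedModel x))
  let ρ : HistRule (Fin 3) (Fin 4) (Fin 2) := fun t => match t with
    | 0 => fun _ => stdSimplex.barycenter
    | _ + 1 => fun x => stdSimplex.vertex (revealedModel x)
  -- The adversary may copy the belief: uniform at first, then the revealed point mass.
  refine ⟨p, ρ, ρ, fun x φ => ?_, ?_, ?_⟩
  · change (stdSimplex.barycenter : stdSimplex ℝ (Fin 2)).1 φ = _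
    rw [stdSimplex.barycenter_apply, one_div]
  · rintro (_ | t) x _
    · exact isSaddlePointOn_air_barycenter hT hε0 hε hη hη1
    · refine ((threeArm T ε).isSaddlePointOn_air_vertex_iff hη).2 ⟨rfl, fun a ha => ?_⟩
      rw [stdSimplex.eq_of_vertex_pos ha]
      exact hbest _
  · rintro t x ⟨i, hx⟩
    have hrev : revealedModel x = i := by
      obtain ⟨ha, hl⟩ := (threeArm T ε).arm_law_pos p hx 0
      have ha2 : (x 0).1 = 2 := stdSimplex.eq_of_vertex_pos ha
      rw [ha2] at hl
      exact revealedModel_eq hl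
    have hl := ((threeArm T ε).arm_law_pos p hx (Fin.last t)).2
    have hnew : ρ (t + 1) x = stdSimplex.vertex i := by rw [← hrev]
    rw [hnew]
    cases t with
    | zero =>
      have ha2 : (x (Fin.last 0)).1 = 2 :=
        stdSimplex.eq_of_vertex_pos ((threeArm T ε).arm_law_pos p hx (Fin.last 0)).1
      refine ((threeArm T ε).updateObj_minimal_iff ?_ ?_).2 rfl
      · rw [ha2] at hl ⊢
        exact posterior_third (by simp [ρ]) hl
      · change klVec _ (stdSimplex.barycenter : stdSimplex ℝ (Fin 2)).1 ≠ ∞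
        rw [klVec_vertex_barycenter]
        exact ENNReal.ofReal_ne_top
    | succ t =>
      have hold : ρ (t + 1) (x.take (t + 1) (t + 1).le_succ) = stdSimplex.vertex i := by
        rw [← hrev]
        rfl
      refine ((threeArm T ε).updateObj_minimal_iff ?_ ?_).2 rfl
      · rw [hold]
        exact (threeArm T ε).posterior_vertex hl
      · rw [hold, klVec_self]
        exact ENNReal.zero_ne_top

end ThreeArm

theorem mainTheorem5 :
    ∃ c : ℝ, 0 < c ∧ ∀ (T : ℕ), 1 ≤ T → ∀ (ε : ℝ), 0 < ε → ε < gap T →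
      ∀ (η : ℝ), 0 < η → η ≤ 1 →
      -- optimistic E2D, whatever the estimation oracle `ρ` and the batch length `τ`
      (∀ (τ : ℕ), 1 ≤ τ → ∀ (ρ : HistRule (Fin 3) (Fin 4) (Fin 2)),
        (∃ p, (threeArm T ε).IsOptimisticE2D η τ ρ p) ∧
        ∀ p, (threeArm T ε).IsOptimisticE2D η τ ρ p →
          (∀ (i : Fin 2) (n : ℕ) (x : Hist (Fin 3) (Fin 4) n),
            0 < (threeArm T ε).histProb p i x → ∀ t, (x t).1 ≠ 2) ∧
          ∃ i : Fin 2, c * √(T : ℝ) ≤ ⨆ a, (threeArm T ε).expectedRegret p i T a) ∧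
      -- the dual-information-gain algorithm
      (∃ p ν ρ, (threeArm T ε).IsDigE2D η p ν ρ) ∧
      ∀ p ν ρ, (threeArm T ε).IsDigE2D η p ν ρ →
        (∀ h : Hist (Fin 3) (Fin 4) 0, (p 0 h).1 2 = 1) ∧
        (∀ (i : Fin 2) (t : ℕ), 1 ≤ t → ∀ h : Hist (Fin 3) (Fin 4) t,
          0 < (threeArm T ε).histProb p i h →
            (ρ t h).1 i = 1 ∧
            ∀ a, 0 < (p t h).1 a → (threeArm T ε).value i a = (threeArm T ε).optValue i) ∧
        ∀ i : Fin 2, (⨆ a, (threeArm T ε).expectedRegret p i T a) ≤ 1 := by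
  refine ⟨1 / 64, by norm_num, fun T hT ε hε0 hε η hη hη1 => ⟨fun τ _ ρ => ⟨?_, fun p hp => ?_⟩,
    exists_isDigE2D hT hε0 hε hη hη1, fun p ν ρ h => ⟨?_, ?_, ?_⟩⟩⟩
  · exact (threeArm T ε).exists_isOptimisticE2D η τ ρ
  · have hz := optimisticE2D_third_eq_zero hT hε hη hp
    exact ⟨fun i n x hx => arm_ne_of_forall_reachable hz hx, exists_regret_ge hT hz⟩
  · exact fun x => (digE2D_first_round hT hε0 hε hη hη1 h x).1
  · intro i t ht x hx
    obtain ⟨n, rfl⟩ : ∃ n, t = n + 1 := ⟨t - 1, by omega⟩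
    exact ⟨by rw [digE2D_belief hT hε0 hε hη hη1 h i n x hx]; simp,
      fun a ha => digE2D_optimal hT hε0 hε hη hη1 h hx ha⟩
  · exact fun i => ciSup_le fun a => digE2D_regret_le hT hε0 hε hη hη1 h i a
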